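/- Let $\mathcal{L}'_g=\{R\}\cup\{D_k : k<\omega\}$ be the language of graphs $\{R\}$ expanded by binary relation symbols $D_k$; in a graph, $R$ is interpreted as adjacency and $D_k(a,b)$ as "the distance between $a$ and $b$ is equal to $k$". **Theorem.** Let $\varphi(x,\overline{y})$ be an $\mathcal{L}'_g$-formula in one object variable $x$, with a finite (possibly empty) tuple $\overline{y}$ of parameter variables. There are finitely many polynomials $p_1,\dots,p_k\in\mathbb{Z}[t_1,t_2]$ and $\mathcal{L}'_g$-formulas $\psi_1(\overline{y}),\dots,\psi_k(\overline{y})$, depending only on $\varphi$, such that the following holds. Let $(H_n)_{n<\omega}$ be any sequence of finite graphs such that $H_n$ is $d(n)$-regular for every $n$, $d(n)\to\infty$ and $\operatorname{girth}(H_n)\to\infty$ (the girth is the length of a shortest cycle, and $\infty$ if there is none), and let $\mathcal{U}$ be any ultrafilter on $\omega$ such that the graph $\mathcal{M}=\prod_{\mathcal{U}}H_n$ is infinite. Put $\alpha=[\,|H_n|\,]_{\mathcal{U}}$ and $\beta=[d(n)]_{\mathcal{U}}$ in $\mathbb{R}^{\mathcal{U}}$. Then: 1. the sets $\psi_1(\mathcal{M}),\dots,\psi_k(\mathcal{M})$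 form a partition of $\mathcal{M}^{|\overline{y}|}$ into non-empty sets; 2. for every $i\le k$ and every $\overline{a}\in\mathcal{M}^{|\overline{y}|}$, $$\mathcal{M}\models\psi_i(\overline{a})\iff |\varphi(\mathcal{M},\overline{a})|=p_i(\alpha,\beta).$$ Here $|X|=c$ means that $X=[X_n]_{\mathcal{U}}$ is the internal subset of $\mathcal{M}$ given by some sets $X_n\subseteq H_n$, and that $c$ is its non-standard cardinality $[\,|X_n|\,]_{\mathcal{U}}\in\mathbb{R}^{\mathcal{U}}$ (which does not depend on the choice of the $X_n$). -/

import Mathlib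

open Filter Topology

/-- The relation symbols of the extended language of graphs: the edge relation `R` and, for every
natural number `k`, a binary symbol `D_k`. -/
inductive DistGraphRel : ℕ → Type
  | adj : DistGraphRel 2
  | dist (k : ℕ) : DistGraphRel 2

/-- The extended language of graphs `{R} ∪ {D_k : k < ω}`. -/
def distGraphLanguage : FirstOrder.Language.{0, 0} := ⟨fun _ => Empty, DistGraphRel⟩

/-- A graph as a structure in the extended language: `R` is adjacency, and `D_k(a, b)` says that
the distance from `a` to `b` is `k` (`edist` is `⊤` when there is no path from `a` to `b`). -/
abbrev distGraphStructure {V : Type*} (G : SimpleGraph V) : distGraphLanguage.Structure V where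
  funMap := fun f => Empty.elim f
  RelMap := fun {_} r => match r with
    | .adj => fun x => G.Adj (x 0) (x 1)
    | .dist k => fun x => G.edist (x 0) (x 1) = k

section Ultraproduct

universe v

variable {V : ℕ → Type v}

/-- The ultraproduct of the graphs `H n`, on Mathlib's ultraproduct of the vertex sets: two elements
are adjacent when representatives are adjacent for `u`-almost all indices. -/
def ultraproductGraph (H : ∀ n, SimpleGraph (V n)) (u : Ultrafilter ℕ) :
    SimpleGraph ((u : Filter ℕ).Product V) where
  Adj x y := ∃ f g : ∀ n, V n, (f : (u : Filter ℕ).Product V) = x ∧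
    (g : (u : Filter ℕ).Product V) = y ∧ ∀ᶠ n in u, (H n).Adj (f n) (g n)
  symm := ⟨by
    rintro x y ⟨f, g, hf, hg, h⟩
    exact ⟨g, f, hg, hf, h.mono fun n hn => hn.symm⟩⟩
  loopless := ⟨by
    rintro x ⟨f, g, hf, hg, h⟩
    have hfg : ∀ᶠ n in (u : Filter ℕ), f n = g n := Quotient.exact (hf.trans hg.symm)
    obtain ⟨n, h1, h2⟩ := (h.and hfg).exists
    exact h1.ne h2⟩

theorem ultraproductGraph_adj_coe (H : ∀ n, SimpleGraph (V n)) (u : Ultrafilter ℕ)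
    (f g : ∀ n, V n) :
    (ultraproductGraph H u).Adj (f : (u : Filter ℕ).Product V) (g : (u : Filter ℕ).Product V) ↔
      ∀ᶠ n in u, (H n).Adj (f n) (g n) := by
  constructor
  · rintro ⟨f', g', hf, hg, h⟩
    have hf' : ∀ᶠ n in (u : Filter ℕ), f' n = f n := Quotient.exact hf
    have hg' : ∀ᶠ n in (u : Filter ℕ), g' n = g n := Quotient.exact hg
    filter_upwards [h, hf', hg'] with n h1 h2 h3
    rwa [← h2, ← h3]
  · exact fun h => ⟨f, g, rfl, rfl, h⟩

/-- The internal set `[S n]_u`: the classes of the sequences that lie in `S n` for `u`-almost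
all `n`. -/
def internalSet (u : Ultrafilter ℕ) (S : ∀ n, Set (V n)) : Set ((u : Filter ℕ).Product V) :=
  {x | ∃ f : ∀ n, V n, (f : (u : Filter ℕ).Product V) = x ∧ ∀ᶠ n in u, f n ∈ S n}

theorem coe_mem_internalSet (u : Ultrafilter ℕ) (S : ∀ n, Set (V n)) (f : ∀ n, V n) :
    (f : (u : Filter ℕ).Product V) ∈ internalSet u S ↔ ∀ᶠ n in u, f n ∈ S n := by
  constructor
  · rintro ⟨f', hf, h⟩
    have hf' : ∀ᶠ n in (u : Filter ℕ), f' n = f n := Quotient.exact hf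
    filter_upwards [h, hf'] with n h1 h2
    rwa [← h2]
  · exact fun h => ⟨f, rfl, h⟩

/-- The set `X` is internal, `X = [S n]_u`, and its non-standard cardinality `[|S n|]_u`, an element
of `ℝ^u`, is `c`. -/
def HasNonstandardCard [∀ n, Finite (V n)] (u : Ultrafilter ℕ)
    (X : Set ((u : Filter ℕ).Product V)) (c : Germ (u : Filter ℕ) ℝ) : Prop :=
  ∃ S : ∀ n, Set (V n), X = internalSet u S ∧
    c = ((fun n => ((S n).ncard : ℝ) : ℕ → ℝ) : Germ (u : Filter ℕ) ℝ)

/-- The non-standard cardinality of an internal set is well defined. -/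
theorem HasNonstandardCard.unique [∀ n, Finite (V n)] [∀ n, Nonempty (V n)] {u : Ultrafilter ℕ}
    {X : Set ((u : Filter ℕ).Product V)} {c c' : Germ (u : Filter ℕ) ℝ}
    (h : HasNonstandardCard u X c) (h' : HasNonstandardCard u X c') : c = c' := by
  classical
  have key : ∀ S T : ∀ n, Set (V n), internalSet u S ⊆ internalSet u T →
      ∀ᶠ n in u, S n ⊆ T n := by
    intro S T hST
    by_contra hcon
    rw [← Ultrafilter.eventually_not] at hcon
    have hex : ∀ n, ∃ x : V n, ¬ S n ⊆ T n → x ∈ S n ∧ x ∉ T n := by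
      intro n
      by_cases hn : S n ⊆ T n
      · exact ⟨Classical.arbitrary _, fun h => absurd hn h⟩
      · obtain ⟨x, hx⟩ := Set.not_subset.mp hn
        exact ⟨x, fun _ => hx⟩
    choose f hf using hex
    have h1 : (f : (u : Filter ℕ).Product V) ∈ internalSet u S :=
      (coe_mem_internalSet u S f).2 (hcon.mono fun n hn => (hf n hn).1)
    have h2 := (coe_mem_internalSet u T f).1 (hST h1)
    obtain ⟨n, hn, hn'⟩ := (hcon.and h2).exists
    exact (hf n hn).2 hn'
  obtain ⟨S, hS, rfl⟩ := h
  obtain ⟨T, hT, rfl⟩ := h'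
  refine Germ.coe_eq.2 ?_
  filter_upwards [key S T (by rw [← hS, ← hT]), key T S (by rw [← hS, ← hT])] with n h1 h2
  rw [Set.Subset.antisymm h1 h2]

end Ultraproduct

/-! Call an integer function of tuples of vertices tame if, on all regular graphs of large enough
degree and girth, it is a fixed integer polynomial in the order, the degree and the indicators of
"the distance from `a i` to `a j` is `k`". The heart is that summing over a vertex preserves
tameness (`Tame.sum_univ`). Locally the graph is a tree: at most one neighbour of `u` leads towards
a given nearby point, and whether two points share that neighbour is decided by their distance. This
settles sums over neighbours (`Tame.sum_nbrs`); induction on the radius settles spheres.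

The order outgrows every power of the degree (Moore bound), so a nonzero polynomial in order and
degree is eventually nonzero. Hence non-vanishing of a tame function is tame
(`Tame.truthValue_ne_zero`), and counting counterexamples eliminates quantifiers. The number of
solutions of a formula is therefore tame: it is one of finitely many polynomials, selected by which
of finitely many distance conditions hold. `valueFormula` expresses the selection, and Łoś's theorem
carries it to the ultraproduct. -/

namespace SimpleGraph

/-! ### Local tree geometry of graphs of large girth. -/

variable {V : Type*} {G : SimpleGraph V}

/-- Up to radius `K`, the graph `G` looks like a forest: a vertex has at most one neighbour that is
closer to a given vertex, and adjacent vertices are never equidistant from a third vertex. -/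
structure IsTreelike (G : SimpleGraph V) (K : ℕ) : Prop where
  eq_of_closer : ∀ {u v b b' : V} {m : ℕ}, m < K → G.Adj u b → G.Adj u b' →
    G.edist u v = (m + 1 : ℕ) → G.edist b v = m → G.edist b' v = m → b = b'
  not_equidistant : ∀ {u v b : V} {m : ℕ}, m < K → G.Adj u b →
    G.edist u v = m → G.edist b v ≠ m

theorem IsTreelike.mono {K L : ℕ} (h : G.IsTreelike L) (hKL : K ≤ L) : G.IsTreelike K :=
  ⟨fun hm => h.eq_of_closer (hm.trans_le hKL), fun hm => h.not_equidistant (hm.trans_le hKL)⟩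

theorem Adj.edist_le_add_one {u b : V} (h : G.Adj u b) (v : V) :
    G.edist b v ≤ G.edist u v + 1 := by
  calc G.edist b v ≤ G.edist b u + G.edist u v := G.edist_triangle
    _ = G.edist u v + 1 := by rw [edist_eq_one_iff_adj.2 h.symm, add_comm]

theorem Adj.edist_eq_of_isTreelike {K m : ℕ} (hG : G.IsTreelike K) (hm : m < K) {u b v : V}
    (h : G.Adj u b) (hu : G.edist u v = m) :
    G.edist b v = (m + 1 : ℕ) ∨ ∃ m', m = m' + 1 ∧ G.edist b v = m' := by
  have h1 := h.edist_le_add_one v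
  have h2 := h.symm.edist_le_add_one v
  have h3 := hG.not_equidistant hm h hu
  rw [hu] at h1 h2
  have hne : G.edist b v ≠ ⊤ := fun h => by
    rw [h] at h1; exact absurd h1 (by exact_mod_cast not_le_of_gt (ENat.natCast_lt_top (m + 1)))
  lift G.edist b v to ℕ using hne with k hk
  norm_cast at h1 h2 h3 ⊢
  rcases lt_or_gt_of_ne h3 with h | h
  · exact Or.inr ⟨k, by lia, rfl⟩
  · exact Or.inl (by lia)

theorem exists_adj_edist_eq {u v : V} {m : ℕ} (h : G.edist u v = (m + 1 : ℕ)) :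
    ∃ b, G.Adj u b ∧ G.edist b v = m := by
  obtain ⟨p, hp⟩ := exists_walk_of_edist_eq_coe h
  cases p with
  | nil => simp at hp
  | @cons _ b _ hadj q =>
    refine ⟨b, hadj, le_antisymm ?_ ?_⟩
    · have := edist_le q
      rw [Walk.length_cons] at hp
      rwa [show q.length = m by lia] at this
    · have := hadj.symm.edist_le_add_one v
      rw [h] at this
      push_cast at this
      exact (ENat.add_le_add_iff_right (by simp)).1 this

/-- A geodesic that leaves `u` away from `v` stays a geodesic when prolonged backwards to `v`. -/
theorem IsTreelike.edist_eq_add {K : ℕ} (hG : G.IsTreelike K) {v : V} :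
    ∀ {m n : ℕ} {u b w : V}, n + m < K → G.Adj u b → G.edist u v = n →
      G.edist b v = (n + 1 : ℕ) → G.edist u w = (m + 1 : ℕ) → G.edist b w = m →
      G.edist w v = (n + m + 1 : ℕ)
  | 0, n, u, b, w, _, _, _, hbv, _, hbw => by
    obtain rfl : b = w := (G.edist_eq_zero_iff).1 (by rw [hbw]; rfl)
    simpa using hbv
  | m + 1, n, u, b, w, hK, hub, huv, hbv, huw, hbw => by
    obtain ⟨c, hbc, hcw⟩ := exists_adj_edist_eq hbw
    -- Otherwise `c` and `u` are both neighbours of `b` closer to `v`, so `c = u`; but `c` is nearer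
    -- to `w` than `u` is.
    have hcv : G.edist c v = (n + 1 + 1 : ℕ) := by
      rcases hbc.edist_eq_of_isTreelike hG (by lia) hbv with h | ⟨m', hm', h⟩
      · exact h
      · obtain rfl : n = m' := by lia
        obtain rfl := hG.eq_of_closer (by lia) hbc hub.symm hbv h huv
        rw [hcw] at huw
        norm_cast at huw
        lia
    have := hG.edist_eq_add (m := m) (by lia) hbc hbv hcv hbw hcw
    rw [this]
    congr 1
    lia

/-- The neighbours of `u` towards `v` and towards `w` agree exactly when the distance from `v` to
`w` is shorter than the detour through `u`. -/
theorem IsTreelike.edist_lt_iff {K m n : ℕ} (hG : G.IsTreelike K) (hK : n + m + 1 < K)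
    {u v w b : V} (hub : G.Adj u b) (huv : G.edist u v = (n + 1 : ℕ)) (hbv : G.edist b v = n)
    (huw : G.edist u w = (m + 1 : ℕ)) :
    G.edist b w = m ↔ G.edist v w < (n + m + 2 : ℕ) := by
  constructor
  · intro hbw
    calc G.edist v w ≤ G.edist v b + G.edist b w := G.edist_triangle
      _ = (n + m : ℕ) := by rw [edist_comm, hbv, hbw]; push_cast; rfl
      _ < (n + m + 2 : ℕ) := by norm_cast; lia
  · intro hlt
    by_contra hbw
    have hbw' : G.edist b w = (m + 1 + 1 : ℕ) := by
      rcases hub.edist_eq_of_isTreelike hG (by lia) huw with h | ⟨m', hm', h⟩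
      · exact h
      · obtain rfl : m = m' := by lia
        exact absurd h hbw
    -- Now `b` starts a geodesic from `u` to `v` that leads away from `w`, so the detour through `u`
    -- is the true distance.
    have := hG.edist_eq_add (v := w) (by lia) hub huw hbw' huv hbv
    rw [this] at hlt
    norm_cast at hlt
    lia

theorem exists_isPath_of_edist_eq {u v : V} {m : ℕ} (h : G.edist u v = m) :
    ∃ p : G.Walk u v, p.IsPath ∧ p.length = m := by
  have hr : G.Reachable u v := reachable_of_edist_ne_top (by simp [h])
  obtain ⟨p, hp, hl⟩ := hr.exists_path_of_dist
  refine ⟨p, hp, ?_⟩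
  have := hr.coe_dist_eq_edist
  rw [h] at this
  rw [hl]
  exact_mod_cast this

/-- Two distinct paths with common ends contain a cycle no longer than both together. -/
theorem Walk.IsPath.eq_of_length_add_lt_egirth {u v : V} {p q : G.Walk u v} (hp : p.IsPath)
    (hq : q.IsPath) (h : ((p.length + q.length : ℕ) : ℕ∞) < G.egirth) : p = q := by
  by_contra hne
  obtain ⟨w, -, -, c, hc, hl⟩ := hp.exists_isCycle_length_le_add_of_ne hq hne
  have h1 := egirth_le_length hc
  exact absurd (h1.trans (by exact_mod_cast hl)) (not_le_of_gt h)

/-- This allows `u` to be prepended to a path: if `u` lay on `p`, the rest of `p` from `u` on would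
be a strictly shorter walk to `v`. -/
theorem Walk.notMem_support_of_length_lt_edist {b v u : V} (p : G.Walk b v)
    (h : (p.length : ℕ∞) < G.edist u v + 1) (hne : u ≠ b) : u ∉ p.support := by
  classical
  intro hu
  have h1 := edist_le (p.dropUntil u hu)
  have h2 : (p.dropUntil u hu).length < p.length := Walk.length_dropUntil_lt_length hu hne
  have h3 : ((p.dropUntil u hu).length + 1 : ℕ) ≤ (p.length : ℕ∞) := by exact_mod_cast h2
  push_cast at h3
  exact absurd (h.trans_le (add_le_add_left h1 1)) (not_lt_of_ge h3)

/-- A graph of large girth is treelike up to a large radius. -/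
theorem isTreelike_of_lt_egirth {K : ℕ} (h : ((2 * K + 2 : ℕ) : ℕ∞) < G.egirth) :
    G.IsTreelike K := by
  have key : ∀ {u v b : V} {m : ℕ}, G.Adj u b → (m : ℕ∞) < G.edist u v + 1 → G.edist b v = m →
      ∃ p : G.Walk u v, p.IsPath ∧ p.length = m + 1 ∧ p.snd = b := by
    intro u v b m hub huv hbv
    obtain ⟨p, hp, hl⟩ := exists_isPath_of_edist_eq hbv
    refine ⟨.cons hub p, hp.cons (p.notMem_support_of_length_lt_edist (by rwa [hl]) hub.ne),
      by simp [hl], by simp⟩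
  constructor
  · intro u v b b' m hm hub hub' huv hb hb'
    have hlt : (m : ℕ∞) < G.edist u v + 1 := by rw [huv]; norm_cast; lia
    obtain ⟨p, hp, hpl, hps⟩ := key hub hlt hb
    obtain ⟨q, hq, hql, hqs⟩ := key hub' hlt hb'
    have := hp.eq_of_length_add_lt_egirth hq (lt_of_le_of_lt (by norm_cast; lia) h)
    rw [← hps, ← hqs, this]
  · intro u v b m hm hub huv hb
    obtain ⟨p, hp, hpl, hps⟩ := key hub (by rw [huv]; norm_cast; lia) hb
    obtain ⟨q, hq, hql⟩ := exists_isPath_of_edist_eq huv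
    have := hp.eq_of_length_add_lt_egirth hq (lt_of_le_of_lt (by norm_cast; lia) h)
    rw [this] at hpl
    lia

end SimpleGraph

-- Regular graphs of large degree and girth.

universe v

/-- A finite graph, together with a natural number that plays the role of its degree. -/
structure GraphModel where
  V : Type v
  [fintype : Fintype V]
  graph : SimpleGraph V
  degree : ℕ

attribute [instance] GraphModel.fintype

namespace GraphModel

open scoped Classical in
/-- The neighbours of a vertex. -/
noncomputable def nbrs (M : GraphModel.{v}) (x : M.V) : Finset M.V :=
  Finset.univ.filter fun y => M.graph.Adj x y

@[simp]
theorem mem_nbrs {M : GraphModel.{v}} {x y : M.V} : y ∈ M.nbrs x ↔ M.graph.Adj x y := by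
  simp [nbrs]

/-- Regular graphs of large degree, treelike up to a large radius, and with very many vertices
compared to the degree. -/
structure Good (M : GraphModel.{v}) (N : ℕ) : Prop where
  card_nbrs : ∀ x, (M.nbrs x).card = M.degree
  treelike : M.graph.IsTreelike N
  le_degree : N ≤ M.degree
  pow_le : M.degree ^ N ≤ Fintype.card M.V

/-- The filter of regular graphs whose degree and girth tend to infinity. -/
def goodFilter : Filter GraphModel.{v} := ⨅ N : ℕ, 𝓟 {M | M.Good N}

theorem eventually_good (N : ℕ) : ∀ᶠ M : GraphModel.{v} in goodFilter, M.Good N :=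
  mem_iInf_of_mem N (mem_principal_self _)

/-- The value of a polynomial at the number of vertices and the degree. -/
noncomputable def sizeEval (M : GraphModel.{v}) : MvPolynomial (Fin 2) ℤ →+* ℤ :=
  MvPolynomial.eval ![(Fintype.card M.V : ℤ), (M.degree : ℤ)]

end GraphModel

/-! ### Eventual non-vanishing of polynomials in order and degree. -/

section Growth

/-- A nonzero polynomial does not vanish where the variable eventually exceeds every coefficient. -/
theorem Polynomial.eventually_eval₂_ne_zero {I R : Type*} [CommRing R] [Nontrivial R] {l : Filter I}
    (f : I → R →+* ℤ) (x : I → ℤ)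
    (h : ∀ a : R, a ≠ 0 → ∀ᶠ i in l, f i a ≠ 0 ∧ |f i a| < x i) (p : Polynomial R) (hp : p ≠ 0) :
    ∀ᶠ i in l, p.eval₂ (f i) (x i) ≠ 0 := by
  induction p using Polynomial.recOnHorner with
  | M0 => exact absurd rfl hp
  | MC p a hp0 ha _ =>
    filter_upwards [h a ha] with i hi heq
    obtain ⟨q, rfl⟩ := Polynomial.X_dvd_iff.2 hp0
    rw [Polynomial.eval₂_add, Polynomial.eval₂_C, Polynomial.eval₂_mul, Polynomial.eval₂_X] at heq
    -- At a zero, `x i` would divide the constant term, which is nonzero and smaller in absolute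
    -- value.
    have hdvd : x i ∣ f i a := ⟨-q.eval₂ (f i) (x i), by linarith⟩
    exact hi.1 (Int.eq_zero_of_abs_lt_dvd hdvd hi.2)
  | MX p hp' ih =>
    filter_upwards [ih hp', h 1 one_ne_zero] with i hi h1
    rw [Polynomial.eval₂_mul, Polynomial.eval₂_X]
    exact mul_ne_zero hi (by have := abs_nonneg (f i 1); lia)

/-- A single `N` is both threshold and exponent, to match the two roles of `N` in `Good`. -/
theorem Polynomial.exists_abs_eval_lt_pow (p : Polynomial ℤ) :
    ∃ N : ℕ, ∀ d : ℕ, N ≤ d → |p.eval (d : ℤ)| < (d : ℤ) ^ N := by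
  induction p using Polynomial.induction_on' with
  | add p q hp hq =>
    obtain ⟨N₁, h₁⟩ := hp
    obtain ⟨N₂, h₂⟩ := hq
    refine ⟨N₁ + N₂ + 2, fun d hd => ?_⟩
    have hd2 : (2 : ℤ) ≤ d := by exact_mod_cast (by lia : 2 ≤ d)
    have hle : ∀ {n : ℕ}, n ≤ N₁ + N₂ → (d : ℤ) ^ n ≤ (d : ℤ) ^ (N₁ + N₂) := fun hn =>
      pow_le_pow_right₀ (by linarith) hn
    have h1 := (h₁ d (by lia)).trans_le (hle (by lia))
    have h2 := (h₂ d (by lia)).trans_le (hle (by lia))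
    rw [Polynomial.eval_add]
    have h3 : 2 * (d : ℤ) ^ (N₁ + N₂) ≤ (d : ℤ) ^ (N₁ + N₂ + 2) := by
      have h5 : (2 : ℤ) ≤ (d : ℤ) ^ 2 := by nlinarith
      rw [pow_add _ (N₁ + N₂) 2, mul_comm]
      exact mul_le_mul_of_nonneg_left h5 (by positivity)
    have h4 := abs_add_le (p.eval (d : ℤ)) (q.eval (d : ℤ))
    lia
  | monomial n a =>
    refine ⟨n + a.natAbs + 2, fun d hd => ?_⟩
    rw [Polynomial.eval_monomial, abs_mul, abs_pow, Nat.abs_cast]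
    have h1 : |a| < (d : ℤ) := by rw [Int.abs_eq_natAbs]; exact_mod_cast (by lia)
    have h0 : (0 : ℤ) < d := by exact_mod_cast (by lia : 0 < d)
    calc |a| * (d : ℤ) ^ n < d * (d : ℤ) ^ n := by gcongr
      _ = (d : ℤ) ^ (n + 1) := by ring
      _ ≤ (d : ℤ) ^ (n + a.natAbs + 2) := pow_le_pow_right₀ (by linarith) (by lia)

namespace GraphModel

theorem eventually_eval_degree_ne_zero (p : Polynomial ℤ) (hp : p ≠ 0) :
    ∀ᶠ M : GraphModel.{v} in goodFilter, p.eval (M.degree : ℤ) ≠ 0 := by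
  refine Polynomial.eventually_eval₂_ne_zero (fun _ => RingHom.id ℤ)
    (fun M : GraphModel.{v} => (M.degree : ℤ)) (fun a ha => ?_) p hp
  filter_upwards [eventually_good (a.natAbs + 1)] with M hM
  refine ⟨ha, ?_⟩
  have := hM.le_degree
  rw [RingHom.id_apply, Int.abs_eq_natAbs]
  exact_mod_cast this

theorem eventually_abs_eval_degree_lt (p : Polynomial ℤ) :
    ∀ᶠ M : GraphModel.{v} in goodFilter, |p.eval (M.degree : ℤ)| < (Fintype.card M.V : ℤ) := by
  obtain ⟨N, hN⟩ := p.exists_abs_eval_lt_pow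
  filter_upwards [eventually_good N] with M hM
  exact (hN _ hM.le_degree).trans_le (by exact_mod_cast hM.pow_le)

/-- Read `p` as a polynomial in the order with coefficients in the degree. Nonzero coefficients are
eventually nonzero and, being bounded by a power of the degree, eventually smaller than the order.
-/
theorem eventually_sizeEval_ne_zero {p : MvPolynomial (Fin 2) ℤ} (hp : p ≠ 0) :
    ∀ᶠ M : GraphModel.{v} in goodFilter, M.sizeEval p ≠ 0 := by
  have key := Polynomial.eventually_eval₂_ne_zero (l := goodFilter.{v})
    (fun M => MvPolynomial.eval fun _ : Fin 1 => (M.degree : ℤ))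
    (fun M => (Fintype.card M.V : ℤ)) (fun a ha => ?_) (MvPolynomial.finSuccEquiv ℤ 1 p)
    (by simpa using hp)
  · filter_upwards [key] with M hM
    convert hM using 1
    rw [← Polynomial.eval_map, ← MvPolynomial.eval_eq_eval_mv_eval', sizeEval]
    congr 2
    ext i
    fin_cases i <;> rfl
  · set q := MvPolynomial.uniqueAlgEquiv ℤ (Fin 1) a with hq
    have hq0 : q ≠ 0 := by rwa [hq, EmbeddingLike.map_ne_zero_iff]
    have heval : ∀ d : ℤ, MvPolynomial.eval (fun _ : Fin 1 => d) a = q.eval d := by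
      intro d
      rw [hq]
      clear hq0 hq q ha
      induction a using MvPolynomial.induction_on with
      | C c => simp
      | add a b ha hb => simp [ha, hb]
      | mul_X a i ha => simp [ha]
    filter_upwards [eventually_eval_degree_ne_zero q hq0, eventually_abs_eval_degree_lt q]
      with M h1 h2
    rw [heval]
    exact ⟨h1, h2⟩

end GraphModel

end Growth

/-! ### Truth values and tame functions. -/

open scoped Classical in
/-- The integer `1` or `0`, according to whether the proposition holds. -/
noncomputable def truthValue (p : Prop) : ℤ := if p then 1 else 0

theorem truthValue_of {p : Prop} (h : p) : truthValue p = 1 := if_pos h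

theorem truthValue_of_not {p : Prop} (h : ¬p) : truthValue p = 0 := if_neg h

theorem truthValue_not (p : Prop) : truthValue (¬p) = 1 - truthValue p := by
  by_cases h : p <;> simp [truthValue, h]

theorem truthValue_and (p q : Prop) : truthValue (p ∧ q) = truthValue p * truthValue q := by
  by_cases h : p <;> by_cases h' : q <;> simp [truthValue, h, h']

theorem truthValue_imp (p q : Prop) :
    truthValue (p → q) = 1 - truthValue p * (1 - truthValue q) := by
  by_cases h : p <;> by_cases h' : q <;> simp [truthValue, h, h']

theorem truthValue_ne_zero {p : Prop} : truthValue p ≠ 0 ↔ p := by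
  by_cases h : p <;> simp [truthValue, h]

theorem sum_truthValue_eq_of_existsUnique {α : Type*} {s : Finset α} {p : α → Prop} {x : α}
    (hx : x ∈ s) (hp : ∀ y ∈ s, p y ↔ y = x) (f : α → ℤ) :
    ∑ y ∈ s, truthValue (p y) * f y = f x := by
  rw [Finset.sum_eq_single_of_mem x hx fun y hy hne => by
    rw [truthValue_of_not (fun h => hne ((hp y hy).1 h)), zero_mul],
    truthValue_of ((hp x hx).2 rfl), one_mul]

theorem sum_truthValue_eq_zero {α : Type*} {s : Finset α} {p : α → Prop}
    (hp : ∀ y ∈ s, ¬p y) (f : α → ℤ) : ∑ y ∈ s, truthValue (p y) * f y = 0 :=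
  Finset.sum_eq_zero fun y hy => by rw [truthValue_of_not (hp y hy), zero_mul]

/-- Polynomials in the truth values of the conditions "the distance from `i` to `j` is `k`", with
coefficients that are polynomials in the number of vertices and the degree. -/
abbrev DistPoly (ι : Type) := MvPolynomial (ι × ι × ℕ) (MvPolynomial (Fin 2) ℤ)

namespace GraphModel

variable {ι κ : Type}

/-- The truth value of "the distance from `x` to `y` is `k`". -/
noncomputable def distInd (M : GraphModel.{v}) (x y : M.V) (k : ℕ) : ℤ :=
  truthValue (M.graph.edist x y = k)

theorem distInd_comm (M : GraphModel.{v}) (x y : M.V) (k : ℕ) :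
    M.distInd x y k = M.distInd y x k := by
  rw [distInd, SimpleGraph.edist_comm, distInd]

/-- The value of a `DistPoly` at a tuple of vertices. -/
noncomputable def distEval (M : GraphModel.{v}) (a : ι → M.V) : DistPoly ι →+* ℤ :=
  MvPolynomial.eval₂Hom M.sizeEval fun w => M.distInd (a w.1) (a w.2.1) w.2.2

@[simp]
theorem distEval_C (M : GraphModel.{v}) (a : ι → M.V) (c : MvPolynomial (Fin 2) ℤ) :
    M.distEval a (MvPolynomial.C c) = M.sizeEval c := by
  simp [distEval]

@[simp]
theorem distEval_X (M : GraphModel.{v}) (a : ι → M.V) (w : ι × ι × ℕ) :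
    M.distEval a (MvPolynomial.X w) = M.distInd (a w.1) (a w.2.1) w.2.2 := by
  simp [distEval]

/-- A function of tuples of vertices is tame if it agrees with a `DistPoly` on all regular graphs of
sufficiently large degree and girth. -/
def Tame (F : ∀ M : GraphModel.{v}, (ι → M.V) → ℤ) : Prop :=
  ∃ P : DistPoly ι, ∀ᶠ M in goodFilter, ∀ a, F M a = M.distEval a P

variable {F F' : ∀ M : GraphModel.{v}, (ι → M.V) → ℤ}

theorem Tame.congr (hF : Tame F) (h : ∀ᶠ M in goodFilter, ∀ a, F' M a = F M a) : Tame F' := by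
  obtain ⟨P, hP⟩ := hF
  exact ⟨P, by filter_upwards [hP, h] with M h1 h2 a using (h2 a).trans (h1 a)⟩

theorem tame_sizeEval (c : MvPolynomial (Fin 2) ℤ) :
    Tame fun (M : GraphModel.{v}) (_ : ι → M.V) => M.sizeEval c :=
  ⟨MvPolynomial.C c, Eventually.of_forall fun _ _ => by simp⟩

theorem tame_const (c : ℤ) : Tame fun (M : GraphModel.{v}) (_ : ι → M.V) => c := by
  simpa using tame_sizeEval (ι := ι) (c : MvPolynomial (Fin 2) ℤ)

theorem tame_card : Tame fun (M : GraphModel.{v}) (_ : ι → M.V) => (Fintype.card M.V : ℤ) := by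
  simpa [sizeEval] using tame_sizeEval (ι := ι) (MvPolynomial.X 0 : MvPolynomial (Fin 2) ℤ)

theorem tame_degree : Tame fun (M : GraphModel.{v}) (_ : ι → M.V) => (M.degree : ℤ) := by
  simpa [sizeEval] using tame_sizeEval (ι := ι) (MvPolynomial.X 1 : MvPolynomial (Fin 2) ℤ)

theorem tame_distInd (i j : ι) (k : ℕ) :
    Tame fun (M : GraphModel.{v}) (a : ι → M.V) => M.distInd (a i) (a j) k :=
  ⟨MvPolynomial.X (i, j, k), Eventually.of_forall fun _ _ => by simp⟩

theorem Tame.add (hF : Tame F) (hF' : Tame F') : Tame fun M a => F M a + F' M a := by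
  obtain ⟨P, hP⟩ := hF
  obtain ⟨Q, hQ⟩ := hF'
  exact ⟨P + Q, by filter_upwards [hP, hQ] with M h1 h2 a; rw [map_add, h1, h2]⟩

theorem Tame.sub (hF : Tame F) (hF' : Tame F') : Tame fun M a => F M a - F' M a := by
  obtain ⟨P, hP⟩ := hF
  obtain ⟨Q, hQ⟩ := hF'
  exact ⟨P - Q, by filter_upwards [hP, hQ] with M h1 h2 a; rw [map_sub, h1, h2]⟩

theorem Tame.mul (hF : Tame F) (hF' : Tame F') : Tame fun M a => F M a * F' M a := by
  obtain ⟨P, hP⟩ := hF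
  obtain ⟨Q, hQ⟩ := hF'
  exact ⟨P * Q, by filter_upwards [hP, hQ] with M h1 h2 a; rw [map_mul, h1, h2]⟩

theorem tame_list_prod {β : Type*} (l : List β) {f : β → ∀ M : GraphModel.{v}, (ι → M.V) → ℤ}
    (hf : ∀ b, Tame (f b)) : Tame fun M a => (l.map fun b => f b M a).prod := by
  induction l with
  | nil => simpa using tame_const 1
  | cons b l ih => simpa using (hf b).mul ih

theorem tame_finset_sum {β : Type*} (s : Finset β) {f : β → ∀ M : GraphModel.{v}, (ι → M.V) → ℤ}
    (hf : ∀ b, Tame (f b)) : Tame fun M a => ∑ b ∈ s, f b M a := by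
  classical
  induction s using Finset.induction_on with
  | empty => simpa using tame_const 0
  | insert b s hb ih => simpa [Finset.sum_insert hb] using (hf b).add ih

theorem distEval_rename (M : GraphModel.{v}) (g : κ → ι) (a : ι → M.V) (P : DistPoly κ) :
    M.distEval a (MvPolynomial.rename (Prod.map g (Prod.map g id)) P) = M.distEval (a ∘ g) P := by
  simp only [distEval, MvPolynomial.coe_eval₂Hom, MvPolynomial.eval₂_rename]
  rfl

theorem Tame.comp {F : ∀ M : GraphModel.{v}, (κ → M.V) → ℤ} (hF : Tame F) (g : κ → ι) :
    Tame fun M (a : ι → M.V) => F M (a ∘ g) := by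
  obtain ⟨P, hP⟩ := hF
  refine ⟨MvPolynomial.rename (Prod.map g (Prod.map g id)) P, ?_⟩
  filter_upwards [hP] with M h a
  rw [distEval_rename, h]

/-- The extension of a tuple by one more entry. -/
def extend {V : Type*} (x : V) (a : ι → V) : Option ι → V := fun o => o.elim x a

@[simp]
theorem extend_none {V : Type*} (x : V) (a : ι → V) : extend x a none = x := rfl

@[simp]
theorem extend_some {V : Type*} (x : V) (a : ι → V) (i : ι) : extend x a (some i) = a i := rfl

/-- To sum a tame function over one variable, it is enough to sum the products of conditions
on the distances from that variable to the other ones. -/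
theorem Tame.sum_of_sum_prod {S : ∀ M : GraphModel.{v}, (ι → M.V) → Finset M.V}
    (hS : ∀ l : List (ι × ℕ),
      Tame fun M a => ∑ x ∈ S M a, (l.map fun p => M.distInd x (a p.1) p.2).prod)
    {F : ∀ M : GraphModel.{v}, (Option ι → M.V) → ℤ} (hF : Tame F) :
    Tame fun M a => ∑ x ∈ S M a, F M (extend x a) := by
  obtain ⟨P, hP⟩ := hF
  -- The list collects the factors that involve `x` as monomials are taken apart; factors free of
  -- `x` are pulled out of the sum.
  suffices h : ∀ l : List (ι × ℕ), Tame fun M a => ∑ x ∈ S M a,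
      M.distEval (extend x a) P * (l.map fun p => M.distInd x (a p.1) p.2).prod by
    refine (h []).congr ?_
    filter_upwards [hP] with M hM a
    simp [hM]
  clear hP F
  induction P using MvPolynomial.induction_on with
  | C c =>
    intro l
    simpa only [distEval_C, Finset.mul_sum] using (tame_sizeEval c).mul (hS l)
  | add P Q hP hQ =>
    intro l
    simpa only [map_add, add_mul, Finset.sum_add_distrib] using (hP l).add (hQ l)
  | mul_X P w ih =>
    intro l
    obtain ⟨i, j, k⟩ := w
    simp only [map_mul, distEval_X]
    cases i with
    | none =>
      cases j with
      | none =>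
        refine ((tame_const (truthValue (k = 0))).mul (ih l)).congr (Eventually.of_forall ?_)
        intro M a
        rw [Finset.mul_sum]
        refine Finset.sum_congr rfl fun x _ => ?_
        simp only [distInd, extend_none, SimpleGraph.edist_self]
        rw [show ((0 : ℕ∞) = k) = (k = 0) by rw [eq_comm (a := (0 : ℕ∞)), Nat.cast_eq_zero]]
        ring
      | some j =>
        refine (ih ((j, k) :: l)).congr (Eventually.of_forall fun M a => ?_)
        refine Finset.sum_congr rfl fun x _ => ?_
        simp only [List.map_cons, List.prod_cons, extend_none, extend_some]
        ring
    | some i =>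
      cases j with
      | none =>
        refine (ih ((i, k) :: l)).congr (Eventually.of_forall fun M a => ?_)
        refine Finset.sum_congr rfl fun x _ => ?_
        simp only [List.map_cons, List.prod_cons, extend_none, extend_some]
        rw [distInd_comm]
        ring
      | some j =>
        refine ((tame_distInd i j k).mul (ih l)).congr (Eventually.of_forall ?_)
        intro M a
        rw [Finset.mul_sum]
        refine Finset.sum_congr rfl fun x _ => ?_
        simp only [extend_some]
        ring

end GraphModel

/-! ### Summation over neighbours, spheres and all vertices. -/

namespace GraphModel

variable {ι : Type}

theorem sum_range_distInd (M : GraphModel.{v}) (x y : M.V) (n : ℕ) :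
    ∑ s ∈ Finset.range n, M.distInd x y s = truthValue (M.graph.edist x y < n) := by
  by_cases h : M.graph.edist x y < n
  · have hne : M.graph.edist x y ≠ ⊤ := (h.trans (ENat.natCast_lt_top n)).ne
    obtain ⟨k, hk⟩ := ENat.ne_top_iff_exists.1 hne
    rw [truthValue_of h, Finset.sum_eq_single k]
    · exact truthValue_of hk.symm
    · intro s _ hs
      refine truthValue_of_not fun h' => hs ?_
      rw [← hk] at h'
      exact_mod_cast h'.symm
    · intro hk'
      rw [← hk] at h
      exact absurd (Finset.mem_range.2 (by exact_mod_cast h)) hk'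
  · rw [truthValue_of_not h]
    refine Finset.sum_eq_zero fun s hs => truthValue_of_not fun h' => h ?_
    rw [h']
    exact_mod_cast Finset.mem_range.1 hs

/-- The truth value of "`x` is at distance `m` from `y`, and `u` at distance `m + 1`". -/
noncomputable def closerInd (M : GraphModel.{v}) (u x y : M.V) (m : ℕ) : ℤ :=
  truthValue (M.graph.edist x y = m ∧ M.graph.edist u y = (m + 1 : ℕ))

/-- Once `b` is known to lead from `u` towards `v`, whether it also leads towards `w` is read off
from distances that do not involve `b`. -/
theorem closerInd_eq {M : GraphModel.{v}} {m n : ℕ} (hM : M.Good (n + m + 2)) {u v w b : M.V}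
    (hub : M.graph.Adj u b) (huv : M.graph.edist u v = (n + 1 : ℕ))
    (hbv : M.graph.edist b v = n) :
    M.closerInd u b w m =
      M.distInd u w (m + 1) * ∑ s ∈ Finset.range (n + m + 2), M.distInd v w s := by
  rw [sum_range_distInd, distInd, ← truthValue_and, closerInd]
  congr 1
  rw [eq_iff_iff, and_comm, and_congr_right_iff]
  intro huw
  exact hM.treelike.edist_lt_iff (by lia) hub huv hbv huw

/-- The first factor leaves at most one neighbour, and `closerInd_eq` evaluates the other factors
there. With no factors the sum is the degree. -/
theorem tame_sum_nbrs_closerInd (i₀ : ι) (l : List (ι × ℕ)) :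
    Tame fun (M : GraphModel.{v}) (a : ι → M.V) =>
      ∑ b ∈ M.nbrs (a i₀), (l.map fun p => M.closerInd (a i₀) b (a p.1) p.2).prod := by
  cases l with
  | nil =>
    refine tame_degree.congr ?_
    filter_upwards [eventually_good 0] with M hM a
    simp [hM.card_nbrs]
  | cons q l =>
    obtain ⟨i, n⟩ := q
    refine ((tame_distInd i₀ i (n + 1)).mul (tame_list_prod l fun p =>
      (tame_distInd i₀ p.1 (p.2 + 1)).mul
        (tame_finset_sum (Finset.range (n + p.2 + 2)) fun s => tame_distInd i p.1 s))).congr ?_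
    have hl : ∀ᶠ M : GraphModel.{v} in goodFilter, ∀ p ∈ l, M.Good (n + p.2 + 2) :=
      (eventually_all_finite (List.finite_toSet l)).2 fun p _ => eventually_good _
    filter_upwards [hl, eventually_good (n + 1)] with M hM hMn a
    simp only [List.map_cons, List.prod_cons]
    by_cases h : M.graph.edist (a i₀) (a i) = (n + 1 : ℕ)
    · obtain ⟨b, hb, hbi⟩ := SimpleGraph.exists_adj_edist_eq h
      have hsum := sum_truthValue_eq_of_existsUnique (s := M.nbrs (a i₀))
        (p := fun b => M.graph.edist b (a i) = n ∧ M.graph.edist (a i₀) (a i) = (n + 1 : ℕ))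
        (mem_nbrs.2 hb) (fun y hy => ⟨fun hy' => hMn.treelike.eq_of_closer (by lia)
          (mem_nbrs.1 hy) hb h hy'.1 hbi, fun hy' => hy' ▸ ⟨hbi, h⟩⟩)
        fun b => (l.map fun p => M.closerInd (a i₀) b (a p.1) p.2).prod
      refine hsum.trans ?_
      rw [distInd, truthValue_of h, one_mul]
      exact congrArg _ (List.map_congr_left fun p hp => closerInd_eq (hM p hp) hb h hbi)
    · rw [distInd, truthValue_of_not h, zero_mul]
      exact sum_truthValue_eq_zero (fun b _ hb => h hb.2) _

theorem distInd_zero_of_adj {M : GraphModel.{v}} {u b : M.V} (hub : M.graph.Adj u b) (y : M.V) :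
    M.distInd b y 0 = M.closerInd u b y 0 := by
  rw [distInd, closerInd]
  congr 1
  rw [eq_iff_iff, iff_self_and]
  intro h
  obtain rfl : b = y := M.graph.edist_eq_zero_iff.1 (by simpa using h)
  simpa using hub

theorem distInd_one_of_adj {M : GraphModel.{v}} (hM : M.Good 2) {u b : M.V}
    (hub : M.graph.Adj u b) (y : M.V) :
    M.distInd b y 1 = M.closerInd u b y 1 + M.distInd u y 0 := by
  by_cases h0 : M.graph.edist u y = (0 : ℕ)
  · obtain rfl : u = y := M.graph.edist_eq_zero_iff.1 (by simpa using h0)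
    rw [distInd, closerInd, distInd, truthValue_of, truthValue_of_not, truthValue_of h0, zero_add]
    · simp
    · simpa using hub.symm
  · rw [distInd, closerInd, distInd, truthValue_of_not h0, add_zero]
    congr 1
    rw [eq_iff_iff, iff_self_and]
    intro h
    rcases hub.symm.edist_eq_of_isTreelike hM.treelike (by lia) h with h' | ⟨m, hm, h'⟩
    · exact h'
    · obtain rfl : m = 0 := by lia
      exact absurd h' h0

/-- If `b` is at distance `k + 2`, then `u` is at `k + 3` or `k + 1`. In the latter case `b` can
only be at `k + 2` or `k`, so the condition on `b` is the complement of `closerInd`. -/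
theorem distInd_add_two_of_adj {M : GraphModel.{v}} {k : ℕ} (hM : M.Good (k + 3)) {u b : M.V}
    (hub : M.graph.Adj u b) (y : M.V) :
    M.distInd b y (k + 2) =
      M.closerInd u b y (k + 2) + M.distInd u y (k + 1) - M.closerInd u b y k := by
  by_cases h0 : M.graph.edist u y = (k + 1 : ℕ)
  · have h1 : M.closerInd u b y (k + 2) = 0 := by
      refine truthValue_of_not fun h => ?_
      rw [h0] at h
      norm_cast at h
      lia
    rw [h1, distInd, distInd, truthValue_of h0, zero_add]
    rcases hub.edist_eq_of_isTreelike hM.treelike (by lia) h0 with h' | ⟨m, hm, h'⟩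
    · rw [truthValue_of h', closerInd, truthValue_of_not, sub_zero]
      rw [h']
      norm_cast
      lia
    · obtain rfl : k = m := by lia
      rw [closerInd, truthValue_of_not, truthValue_of ⟨h', h0⟩, sub_self]
      rw [h']
      norm_cast
      lia
  · have h1 : M.closerInd u b y k = 0 := truthValue_of_not fun h => h0 h.2
    rw [h1, sub_zero, distInd, distInd, truthValue_of_not h0, add_zero, closerInd]
    congr 1
    rw [eq_iff_iff, iff_self_and]
    intro h
    rcases hub.symm.edist_eq_of_isTreelike hM.treelike (by lia) h with h' | ⟨m, hm, h'⟩
    · exact h'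
    · obtain rfl : m = k + 1 := by lia
      exact absurd h' h0

/-- Each factor of `l` is rewritten by `closerInd` factors, moved to `l'`, and terms free of `b`. -/
theorem tame_sum_nbrs_distInd (i₀ : ι) (l l' : List (ι × ℕ)) :
    Tame fun (M : GraphModel.{v}) (a : ι → M.V) => ∑ b ∈ M.nbrs (a i₀),
      (l.map fun p => M.distInd b (a p.1) p.2).prod *
        (l'.map fun p => M.closerInd (a i₀) b (a p.1) p.2).prod := by
  induction l generalizing l' with
  | nil => simpa using tame_sum_nbrs_closerInd i₀ l'
  | cons p l ih =>
    obtain ⟨i, k⟩ := p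
    match k with
    | 0 =>
      refine (ih ((i, 0) :: l')).congr (Eventually.of_forall fun M a => ?_)
      refine Finset.sum_congr rfl fun b hb => ?_
      simp only [List.map_cons, List.prod_cons]
      rw [distInd_zero_of_adj (mem_nbrs.1 hb)]
      ring
    | 1 =>
      refine ((ih ((i, 1) :: l')).add ((tame_distInd i₀ i 0).mul (ih l'))).congr ?_
      filter_upwards [eventually_good 2] with M hM a
      rw [Finset.mul_sum, ← Finset.sum_add_distrib]
      refine Finset.sum_congr rfl fun b hb => ?_
      simp only [List.map_cons, List.prod_cons]
      rw [distInd_one_of_adj hM (mem_nbrs.1 hb)]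
      ring
    | k + 2 =>
      refine (((ih ((i, k + 2) :: l')).add ((tame_distInd i₀ i (k + 1)).mul (ih l'))).sub
        (ih ((i, k) :: l'))).congr ?_
      filter_upwards [eventually_good (k + 3)] with M hM a
      rw [Finset.mul_sum, ← Finset.sum_add_distrib, ← Finset.sum_sub_distrib]
      refine Finset.sum_congr rfl fun b hb => ?_
      simp only [List.map_cons, List.prod_cons]
      rw [distInd_add_two_of_adj hM (mem_nbrs.1 hb)]
      ring

/-- Tame functions are closed under summation over the neighbours of a vertex. -/
theorem Tame.sum_nbrs {F : ∀ M : GraphModel.{v}, (Option ι → M.V) → ℤ} (hF : Tame F) (i₀ : ι) :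
    Tame fun M a => ∑ b ∈ M.nbrs (a i₀), F M (extend b a) :=
  hF.sum_of_sum_prod fun l => by simpa using tame_sum_nbrs_distInd i₀ l []

/-- Each point of the sphere of radius `s + 1` about `u` lies at distance `s` from exactly one
neighbour `b` of `u`, so the sum splits over the `b`. The extra factor with `s + 1` discards points
of the spheres about `b` that are not on the large one. As `b` becomes a new variable, the induction
ranges over all `ι`. -/
theorem tame_sum_distInd_mul (s : ℕ) : ∀ {ι : Type} (i₀ : ι) (l : List (ι × ℕ)),
    Tame fun (M : GraphModel.{v}) (a : ι → M.V) => ∑ x,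
      M.distInd x (a i₀) s * (l.map fun p => M.distInd x (a p.1) p.2).prod := by
  induction s with
  | zero =>
    intro ι i₀ l
    refine (tame_list_prod l fun p => tame_distInd i₀ p.1 p.2).congr
      (Eventually.of_forall fun M a => ?_)
    exact sum_truthValue_eq_of_existsUnique (Finset.mem_univ (a i₀))
      (p := fun x => M.graph.edist x (a i₀) = (0 : ℕ)) (fun y _ => by simp) fun x => (l.map fun p => M.distInd x (a p.1) p.2).prod
  | succ s ih =>
    intro ι i₀ l
    refine ((ih (none : Option ι) ((some i₀, s + 1) :: l.map (Prod.map some id))).sum_nbrs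
      i₀).congr ?_
    filter_upwards [eventually_good (s + 1)] with M hM a
    rw [Finset.sum_comm]
    refine Finset.sum_congr rfl fun x _ => ?_
    simp only [extend_none, List.map_cons, List.prod_cons, extend_some, List.map_map,
      Function.comp_def, Prod.map_fst, Prod.map_snd, id_eq]
    by_cases h : M.graph.edist x (a i₀) = (s + 1 : ℕ)
    · obtain ⟨b, hb, hbx⟩ := SimpleGraph.exists_adj_edist_eq
        (M.graph.edist_comm.trans h)
      refine (sum_truthValue_eq_of_existsUnique (s := M.nbrs (a i₀)) (mem_nbrs.2 hb)
        (fun y hy => ⟨fun hy' => hM.treelike.eq_of_closer (by lia) (mem_nbrs.1 hy) hb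
          (M.graph.edist_comm.trans h) (M.graph.edist_comm.trans hy') hbx, fun hy' => ?_⟩)
        fun _ => M.distInd x (a i₀) (s + 1) *
          (l.map fun p => M.distInd x (a p.1) p.2).prod).symm
      rw [hy', SimpleGraph.edist_comm, hbx]
    · rw [distInd, truthValue_of_not h]
      simp

/-- Tame functions are closed under summation over all vertices. -/
theorem Tame.sum_univ {F : ∀ M : GraphModel.{v}, (Option ι → M.V) → ℤ} (hF : Tame F) :
    Tame fun M a => ∑ x, F M (extend x a) := by
  refine hF.sum_of_sum_prod fun l => ?_
  -- Any factor confines `x` to a sphere; the empty product counts all vertices.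
  cases l with
  | nil => simpa using tame_card
  | cons p l => simpa using tame_sum_distInd_mul p.2 p.1 l

end GraphModel

/-! ### Patterns of distance conditions, and vanishing of tame functions. -/

open scoped Classical in
/-- The conditions in `s` that a tuple of vertices satisfies. -/
noncomputable def SimpleGraph.pattern {V : Type*} {ι : Type} (G : SimpleGraph V) (a : ι → V)
    (s : Finset (ι × ι × ℕ)) : Finset (ι × ι × ℕ) :=
  s.filter fun w => G.edist (a w.1) (a w.2.1) = w.2.2

theorem SimpleGraph.pattern_eq_iff {V : Type*} {ι : Type} {G : SimpleGraph V} {a : ι → V}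
    {s T : Finset (ι × ι × ℕ)} (hT : T ⊆ s) :
    G.pattern a s = T ↔ ∀ w ∈ s, (w ∈ T ↔ G.edist (a w.1) (a w.2.1) = w.2.2) := by
  constructor
  · rintro rfl w hw
    simp [pattern, hw]
  · intro h
    ext w
    by_cases hw : w ∈ s
    · simp [pattern, hw, h w hw]
    · simpa [pattern, hw] using fun h' => hw (hT h')

theorem SimpleGraph.pattern_subset {V : Type*} {ι : Type} (G : SimpleGraph V) (a : ι → V)
    (s : Finset (ι × ι × ℕ)) : G.pattern a s ⊆ s :=
  Finset.filter_subset _ _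

open scoped Classical in
/-- The polynomial in the number of vertices and the degree that is obtained when precisely the
conditions in `T` are declared true. -/
noncomputable def patternEval {ι : Type} (T : Finset (ι × ι × ℕ)) :
    DistPoly ι →+* MvPolynomial (Fin 2) ℤ :=
  MvPolynomial.eval fun w => if w ∈ T then 1 else 0

namespace GraphModel

variable {ι : Type}

/-- The variables take only the values 0 and 1, so only finitely many polynomials in the sizes can
occur. -/
theorem distEval_eq_sizeEval (M : GraphModel.{v}) (a : ι → M.V) (P : DistPoly ι) :
    M.distEval a P = M.sizeEval (patternEval (M.graph.pattern a P.vars) P) := by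
  refine MvPolynomial.hom_congr_vars (f₁ := M.distEval a)
    (f₂ := M.sizeEval.comp (patternEval (M.graph.pattern a P.vars))) ?_ ?_ rfl
  · ext <;> simp [patternEval]
  · intro w hw _
    rw [distEval_X, distInd, RingHom.comp_apply, patternEval, MvPolynomial.eval_X,
      SimpleGraph.pattern]
    by_cases h : M.graph.edist (a w.1) (a w.2.1) = w.2.2
    · simp [truthValue, hw, h]
    · simp [truthValue, hw, h]

theorem tame_truthValue_forall {β : Type*} (s : Finset β)
    {p : β → ∀ M : GraphModel.{v}, (ι → M.V) → Prop}
    (hp : ∀ b, Tame fun M a => truthValue (p b M a)) :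
    Tame fun M a => truthValue (∀ b ∈ s, p b M a) := by
  classical
  induction s using Finset.induction_on with
  | empty => simpa [truthValue] using tame_const 1
  | insert b s hb ih => simpa [truthValue_and] using (hp b).mul ih

theorem tame_truthValue_pattern {s T : Finset (ι × ι × ℕ)} (hT : T ⊆ s) :
    Tame fun (M : GraphModel.{v}) a => truthValue (M.graph.pattern a s = T) := by
  simp only [SimpleGraph.pattern_eq_iff hT]
  refine tame_truthValue_forall s fun w => ?_
  by_cases hw : w ∈ T
  · simpa [hw, distInd] using tame_distInd w.1 w.2.1 w.2.2
  · simpa [hw, truthValue_not, distInd] using (tame_const 1).sub (tame_distInd w.1 w.2.1 w.2.2)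

/-- Whether a tame function vanishes is a tame condition. -/
theorem Tame.truthValue_ne_zero {F : ∀ M : GraphModel.{v}, (ι → M.V) → ℤ} (hF : Tame F) :
    Tame fun M a => truthValue (F M a ≠ 0) := by
  classical
  obtain ⟨P, hP⟩ := hF
  -- On patterns in `t` the value is eventually nonzero, on the others it is identically zero.
  let t := P.vars.powerset.filter fun T => patternEval T P ≠ 0
  have ht : ∀ T ∈ t, ∀ᶠ M : GraphModel.{v} in goodFilter, M.sizeEval (patternEval T P) ≠ 0 :=
    fun T hT => eventually_sizeEval_ne_zero (Finset.mem_filter.1 hT).2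
  have hsum : Tame fun (M : GraphModel.{v}) a =>
      ∑ T ∈ t.attach, truthValue (M.graph.pattern a P.vars = T.1) :=
    tame_finset_sum t.attach fun T => tame_truthValue_pattern
      (Finset.mem_powerset.1 (Finset.mem_filter.1 T.2).1)
  refine hsum.congr ?_
  filter_upwards [hP, (eventually_all_finset t).2 ht] with M h1 h2 a
  rw [h1, distEval_eq_sizeEval, Finset.sum_attach t
    (fun T => truthValue (M.graph.pattern a P.vars = T))]
  set T₀ := M.graph.pattern a P.vars with hT₀
  by_cases hT : patternEval T₀ P = 0
  · rw [truthValue_of_not (by simp [hT])]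
    refine (Finset.sum_eq_zero fun T hTt => truthValue_of_not ?_).symm
    rintro rfl
    exact (Finset.mem_filter.1 hTt).2 hT
  · have hmem : T₀ ∈ t :=
      Finset.mem_filter.2 ⟨Finset.mem_powerset.2 (SimpleGraph.pattern_subset _ _ _), hT⟩
    rw [truthValue_of (h2 _ hmem), Finset.sum_eq_single_of_mem T₀ hmem
      fun T _ hne => truthValue_of_not hne.symm, truthValue_of rfl]

instance (M : GraphModel.{v}) : distGraphLanguage.Structure M.V := distGraphStructure M.graph

end GraphModel

/-! ### Quantifier elimination and counting of solutions. -/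

theorem distGraphLanguage.exists_eq_var {α : Type*} (t : distGraphLanguage.Term α) :
    ∃ i, t = .var i := by
  cases t with
  | var i => exact ⟨i, rfl⟩
  | func f => exact Empty.elim f

namespace GraphModel

variable {α : Type}

/-- The number of counterexamples is tame, and so is the test whether it vanishes. -/
theorem Tame.truthValue_forall {ι : Type} {p : ∀ M : GraphModel.{v}, (Option ι → M.V) → Prop}
    (hp : Tame fun M a => truthValue (p M a)) :
    Tame fun M (a : ι → M.V) => truthValue (∀ x, p M (extend x a)) := by
  refine ((tame_const 1).sub (Tame.sum_univ ((tame_const 1).sub hp)).truthValue_ne_zero).congr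
    (Eventually.of_forall fun M a => ?_)
  rw [← truthValue_not]
  congr 1
  simp only [← truthValue_not, ne_eq, not_not, eq_iff_iff]
  rw [Finset.sum_eq_zero_iff_of_nonneg fun x _ => by unfold truthValue; split_ifs <;> simp]
  refine forall_congr' fun x => ?_
  by_cases h : p M (extend x a) <;> simp [truthValue, h]

/-- Quantifier elimination: truth of a formula is a tame condition. -/
theorem tame_truthValue_realize {n : ℕ} (φ : distGraphLanguage.BoundedFormula α n) :
    Tame fun (M : GraphModel.{v}) (a : α ⊕ Fin n → M.V) =>
      truthValue (φ.Realize (a ∘ Sum.inl) (a ∘ Sum.inr)) := by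
  induction φ with
  | falsum => simpa [FirstOrder.Language.BoundedFormula.Realize, truthValue] using tame_const 0
  | equal t₁ t₂ =>
    obtain ⟨i, rfl⟩ := distGraphLanguage.exists_eq_var t₁
    obtain ⟨j, rfl⟩ := distGraphLanguage.exists_eq_var t₂
    refine (tame_distInd i j 0).congr (Eventually.of_forall fun M a => ?_)
    simp [FirstOrder.Language.BoundedFormula.Realize, distInd]
  | rel R ts =>
    cases R with
    | adj =>
      obtain ⟨i, hi⟩ := distGraphLanguage.exists_eq_var (ts 0)
      obtain ⟨j, hj⟩ := distGraphLanguage.exists_eq_var (ts 1)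
      refine (tame_distInd i j 1).congr (Eventually.of_forall fun M a => ?_)
      simp [FirstOrder.Language.BoundedFormula.Realize, distInd,
        FirstOrder.Language.Structure.RelMap, hi, hj]
    | dist k =>
      obtain ⟨i, hi⟩ := distGraphLanguage.exists_eq_var (ts 0)
      obtain ⟨j, hj⟩ := distGraphLanguage.exists_eq_var (ts 1)
      refine (tame_distInd i j k).congr (Eventually.of_forall fun M a => ?_)
      simp [FirstOrder.Language.BoundedFormula.Realize, distInd,
        FirstOrder.Language.Structure.RelMap, hi, hj]
  | imp φ ψ ihφ ihψ =>
    refine ((tame_const 1).sub (ihφ.mul ((tame_const 1).sub ihψ))).congr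
      (Eventually.of_forall fun M a => ?_)
    exact truthValue_imp _ _
  | @all n φ ih =>
    -- The last bound variable becomes `none`, the variable summed over.
    have h := ih.comp (Sum.elim (some ∘ Sum.inl)
      (Fin.snoc (α := fun _ => Option (α ⊕ Fin n)) (some ∘ Sum.inr) none))
    refine h.truthValue_forall.congr (Eventually.of_forall fun M a => ?_)
    congr 1
    rw [FirstOrder.Language.BoundedFormula.realize_all, eq_iff_iff]
    refine forall_congr' fun x => ?_
    rw [Function.comp_assoc, Function.comp_assoc, Sum.elim_comp_inl, Sum.elim_comp_inr,
      Fin.comp_snoc]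
    rfl

/-- The number of solutions of a formula is a tame function of the parameters. -/
theorem tame_ncard_realize {m : ℕ} (φ : distGraphLanguage.Formula (Unit ⊕ Fin m)) :
    Tame fun (M : GraphModel.{v}) (a : Fin m → M.V) =>
      (({x | φ.Realize (Sum.elim (fun _ => x) a)} : Set M.V).ncard : ℤ) := by
  have h := (tame_truthValue_realize.{v} φ).comp
    (Sum.elim (Sum.elim (fun _ => none) some) Fin.elim0 : _ → Option (Fin m))
  refine h.sum_univ.congr (Eventually.of_forall fun M a => ?_)
  classical
  rw [Set.ncard_eq_toFinset_card', Set.toFinset_ofPred, Finset.card_filter]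
  push_cast
  refine Finset.sum_congr rfl fun x _ => ?_
  rw [truthValue, FirstOrder.Language.Formula.Realize]
  have h1 : (extend x a ∘ Sum.elim (Sum.elim (fun _ => none) some) Fin.elim0) ∘
      (Sum.inl : Unit ⊕ Fin m → (Unit ⊕ Fin m) ⊕ Fin 0) = Sum.elim (fun _ => x) a := by
    ext i
    rcases i with i | i <;> rfl
  rw [h1, Subsingleton.elim (_ ∘ Sum.inr) default]

end GraphModel

/-! ### Moore bound and convergence to `goodFilter`. -/

namespace SimpleGraph

variable {V : Type*} {G : SimpleGraph V}

/-- A first-order recursion for bounded distance, used for the induction in the ultraproduct. -/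
theorem edist_le_succ_iff {x y : V} {k : ℕ} :
    G.edist x y ≤ (k + 1 : ℕ) ↔ ∃ z, (x = z ∨ G.Adj x z) ∧ G.edist z y ≤ k := by
  constructor
  · intro h
    by_cases hk : G.edist x y ≤ k
    · exact ⟨x, Or.inl rfl, hk⟩
    · have heq : G.edist x y = (k + 1 : ℕ) :=
        le_antisymm h (by push_cast; exact Order.add_one_le_of_lt (not_le.1 hk))
      obtain ⟨z, hz, hzy⟩ := exists_adj_edist_eq heq
      exact ⟨z, Or.inr hz, hzy.le⟩
  · rintro ⟨z, rfl | hz, hk⟩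
    · exact hk.trans (by norm_cast; lia)
    · refine (hz.symm.edist_le_add_one y).trans ?_
      push_cast
      exact add_le_add_left hk 1

end SimpleGraph

namespace GraphModel

open scoped Classical in
/-- The Moore bound: spheres in treelike regular graphs grow exponentially. -/
theorem pow_le_card_sphere {M : GraphModel.{v}} {K : ℕ}
    (hreg : ∀ x, (M.nbrs x).card = M.degree) (hK : M.graph.IsTreelike K) (v : M.V) :
    ∀ k ≤ K, (M.degree - 1) ^ k ≤ (Finset.univ.filter fun x => M.graph.edist x v = k).card
  | 0, _ => by
    rw [pow_zero]
    exact Finset.card_pos.2 ⟨v, by simp⟩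
  | k + 1, hk => by
    have ih := pow_le_card_sphere hreg hK v k (by lia)
    rw [pow_succ]
    refine (Nat.mul_le_mul_right _ ih).trans ?_
    rw [← mul_one (Finset.card (Finset.univ.filter fun x => M.graph.edist x v = (k + 1 : ℕ)))]
    -- Double counting of the edges between consecutive spheres: at least `degree - 1` go out of
    -- each `x`, at most one comes in to each `y`.
    refine Finset.card_mul_le_card_mul M.graph.Adj (fun x hx => ?_) (fun y hy => ?_)
    · have hx' : M.graph.edist x v = k := (Finset.mem_filter.1 hx).2
      have hsub : M.nbrs x ⊆ Finset.bipartiteAbove M.graph.Adj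
          (Finset.univ.filter fun x => M.graph.edist x v = (k + 1 : ℕ)) x ∪
          (M.nbrs x).filter fun y => M.graph.edist y v + 1 = k := by
        intro y hy
        rw [Finset.mem_union, Finset.mem_bipartiteAbove, Finset.mem_filter, Finset.mem_filter]
        rcases (mem_nbrs.1 hy).edist_eq_of_isTreelike hK (by lia) hx' with h | ⟨m, rfl, h⟩
        · exact Or.inl ⟨⟨Finset.mem_univ y, h⟩, mem_nbrs.1 hy⟩
        · exact Or.inr ⟨hy, by rw [h]; rfl⟩
      have hone : ((M.nbrs x).filter fun y => M.graph.edist y v + 1 = k).card ≤ 1 := by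
        refine Finset.card_le_one.2 fun y hy z hz => ?_
        rw [Finset.mem_filter, mem_nbrs] at hy hz
        rcases hy.1.edist_eq_of_isTreelike hK (by lia) hx' with h | ⟨m, rfl, h⟩
        · exfalso
          have := hy.2
          rw [h] at this
          norm_cast at this
          lia
        · rcases hz.1.edist_eq_of_isTreelike hK (by lia) hx' with h' | ⟨n, hn, h'⟩
          · exfalso
            have := hz.2
            rw [h'] at this
            norm_cast at this
            lia
          · obtain rfl : m = n := by lia
            exact hK.eq_of_closer (by lia) hy.1 hz.1 hx' h h'
      have := (Finset.card_le_card hsub).trans (Finset.card_union_le _ _)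
      rw [hreg] at this
      lia
    · refine Finset.card_le_one.2 fun x hx z hz => ?_
      rw [Finset.mem_bipartiteBelow, Finset.mem_filter] at hx hz
      exact hK.eq_of_closer (by lia) hx.2.symm hz.2.symm (Finset.mem_filter.1 hy).2 hx.1.2 hz.1.2

/-- The lower bound on the order comes from a sphere of radius `2 * N`, since `d ≤ (d - 1) ^ 2` for
`d ≥ 3`. -/
theorem tendsto_goodFilter {I : Type*} {l : Filter I} {M : I → GraphModel.{v}}
    (hne : ∀ i, Nonempty (M i).V) (hreg : ∀ i x, ((M i).nbrs x).card = (M i).degree)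
    (hd : Tendsto (fun i => (M i).degree) l atTop)
    (hg : Tendsto (fun i => (M i).graph.egirth) l (𝓝 ⊤)) : Tendsto M l goodFilter := by
  refine tendsto_iInf.2 fun N => tendsto_principal.2 ?_
  filter_upwards [hd.eventually_ge_atTop (N + 3),
    hg.eventually (lt_mem_nhds (ENat.natCast_lt_top (2 * (2 * N) + 2)))] with i h1 h2
  have htree := SimpleGraph.isTreelike_of_lt_egirth h2
  refine ⟨hreg i, htree.mono (by lia), by lia, ?_⟩
  obtain ⟨v⟩ := hne i
  calc (M i).degree ^ N ≤ (((M i).degree - 1) ^ 2) ^ N := by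
        refine Nat.pow_le_pow_left ?_ N
        obtain ⟨e, he⟩ := Nat.exists_eq_add_of_le (show 3 ≤ (M i).degree by lia)
        rw [he, show 3 + e - 1 = e + 2 by lia]
        nlinarith
    _ = ((M i).degree - 1) ^ (2 * N) := by rw [pow_mul]
    _ ≤ _ := pow_le_card_sphere (hreg i) htree v (2 * N) le_rfl
    _ ≤ _ := Finset.card_le_univ _

end GraphModel

/-! ### Distances and Łoś's theorem in the ultraproduct. -/

section Ultraproduct

variable {V : ℕ → Type v} (H : ∀ n, SimpleGraph (V n)) (u : Ultrafilter ℕ)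

/-- The symbols `D_k` are read from the distance of the ultraproduct graph itself, so Łoś's theorem
needs this distance to be computed coordinatewise. -/
theorem ultraproductGraph_edist_le_coe (f g : ∀ n, V n) (k : ℕ) :
    (ultraproductGraph H u).edist (f : (u : Filter ℕ).Product V) (g : (u : Filter ℕ).Product V) ≤ k ↔
      ∀ᶠ n in u, (H n).edist (f n) (g n) ≤ k := by
  have heq : ∀ f g : ∀ n, V n, (f : (u : Filter ℕ).Product V) =
      (g : (u : Filter ℕ).Product V) ↔ ∀ᶠ n in u, f n = g n :=
    fun f g => Quotient.eq''
  induction k generalizing f with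
  | zero =>
    refine (nonpos_iff_eq_zero.trans SimpleGraph.edist_eq_zero_iff).trans ((heq f g).trans ?_)
    simp only [Nat.cast_zero, nonpos_iff_eq_zero, SimpleGraph.edist_eq_zero_iff]
  | succ k ih =>
    refine SimpleGraph.edist_le_succ_iff.trans ?_
    simp only [SimpleGraph.edist_le_succ_iff]
    constructor
    · rintro ⟨z, hz, hzg⟩
      obtain ⟨z, rfl⟩ := Quotient.exists_rep z
      filter_upwards [(ih z).1 hzg, Ultrafilter.eventually_or.2 (hz.imp (heq f z).1
        (ultraproductGraph_adj_coe H u f z).1)] with n h1 h2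
      exact ⟨z n, h2, h1⟩
    · intro h
      have hex : ∀ n, ∃ z, (∃ z, (f n = z ∨ (H n).Adj (f n) z) ∧ (H n).edist z (g n) ≤ k) →
          (f n = z ∨ (H n).Adj (f n) z) ∧ (H n).edist z (g n) ≤ k := by
        intro n
        by_cases hn : ∃ z, (f n = z ∨ (H n).Adj (f n) z) ∧ (H n).edist z (g n) ≤ k
        · exact hn.imp fun z hz _ => hz
        · exact ⟨f n, fun h => absurd h hn⟩
      choose z hz using hex
      refine ⟨(z : (u : Filter ℕ).Product V), ?_, (ih z).2 (h.mono fun n hn => (hz n hn).2)⟩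
      exact (Ultrafilter.eventually_or.1 (h.mono fun n hn => (hz n hn).1)).imp (heq f z).2
        (ultraproductGraph_adj_coe H u f z).2

theorem ultraproductGraph_edist_coe (f g : ∀ n, V n) (k : ℕ) :
    (ultraproductGraph H u).edist (f : (u : Filter ℕ).Product V) (g : (u : Filter ℕ).Product V) = k ↔
      ∀ᶠ n in u, (H n).edist (f n) (g n) = k := by
  cases k with
  | zero => simpa using ultraproductGraph_edist_le_coe H u f g 0
  | succ k =>
    have h : ∀ e : ℕ∞, e = (k + 1 : ℕ) ↔ e ≤ (k + 1 : ℕ) ∧ ¬e ≤ k := by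
      intro e
      induction e using ENat.recTopCoe with
      | top => simp [-Nat.cast_add]
      | coe e => norm_cast; lia
    simp only [h, ultraproductGraph_edist_le_coe, ← Ultrafilter.eventually_not, ← eventually_and]

/-- Łoś's theorem for ultraproducts of graphs in the extended language of graphs. -/
theorem ultraproductGraph_realize_coe [∀ n, Nonempty (V n)] {β : Type*}
    (φ : distGraphLanguage.Formula β) (x : β → ∀ n, V n) :
    @FirstOrder.Language.Formula.Realize _ _ (distGraphStructure (ultraproductGraph H u)) _ φ
        (fun i => (x i : (u : Filter ℕ).Product V)) ↔
      ∀ᶠ n in u, @FirstOrder.Language.Formula.Realize _ _ (distGraphStructure (H n)) _ φ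
        fun i => x i n := by
  let _ : ∀ n, distGraphLanguage.Structure (V n) := fun n => distGraphStructure (H n)
  have hstr : distGraphStructure (ultraproductGraph H u) =
      FirstOrder.Language.Ultraproduct.structure := by
    refine FirstOrder.Language.Structure.ext (funext fun n => funext fun f => Empty.elim f) ?_
    funext n r x
    obtain ⟨x, rfl⟩ : ∃ y : Fin n → ∀ n, V n, (fun i => (y i : (u : Filter ℕ).Product V)) = x :=
      ⟨fun i => (x i).out, funext fun i => Quotient.out_eq _⟩
    refine Eq.trans ?_ (propext (FirstOrder.Language.relMap_quotient_mk' _ r x)).symm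
    cases r with
    | adj => exact propext (ultraproductGraph_adj_coe H u (x 0) (x 1))
    | dist k => exact propext (ultraproductGraph_edist_coe H u (x 0) (x 1) k)
  rw [hstr]
  exact FirstOrder.Language.Ultraproduct.realize_formula_cast φ x

/-- A principal ultrafilter would make the ultraproduct embed in one finite factor. Hence limits at
infinity hold along `u`. -/
theorem le_cofinite_of_infinite_product [∀ n, Finite (V n)] [Infinite ((u : Filter ℕ).Product V)] :
    (u : Filter ℕ) ≤ cofinite := by
  rcases u.le_cofinite_or_eq_pure with h | ⟨n, rfl⟩
  · exact h
  · exfalso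
    have hsurj : Function.Injective (fun x : ((pure n : Ultrafilter ℕ) : Filter ℕ).Product V =>
        x.out n) := by
      intro x y hxy
      rw [← Quotient.out_eq x, ← Quotient.out_eq y]
      exact Quotient.sound (show ∀ᶠ m in pure n, x.out m = y.out m from hxy)
    exact not_finite_iff_infinite.2 ‹_› (Finite.of_injective _ hsurj)

theorem nonempty_of_infinite_product [Infinite ((u : Filter ℕ).Product V)] (n : ℕ) :
    Nonempty (V n) :=
  ⟨(Classical.arbitrary ((u : Filter ℕ).Product V)).out n⟩

end Ultraproduct

/-! ### Formulas for patterns and polynomial values. -/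

section ValueFormula

open FirstOrder Language

variable {ι : Type}

/-- The formula saying that the distance from `i` to `j` is `k`. -/
def distFormula (w : ι × ι × ℕ) : distGraphLanguage.Formula ι :=
  Relations.formula₂ (show distGraphLanguage.Relations 2 from DistGraphRel.dist w.2.2) (Term.var w.1)
    (Term.var w.2.1)

open scoped Classical in
/-- The formula saying that precisely the conditions in `T` hold, among those in `s`. -/
noncomputable def patternFormula (s T : Finset (ι × ι × ℕ)) : distGraphLanguage.Formula ι :=
  BoundedFormula.iInf fun w : s => if w.1 ∈ T then distFormula w.1 else (distFormula w.1).not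

/-- The formula saying that `P` takes the value `p`. -/
noncomputable def valueFormula (P : DistPoly ι) (p : MvPolynomial (Fin 2) ℤ) :
    distGraphLanguage.Formula ι :=
  BoundedFormula.iSup fun T : {T : P.vars.powerset // patternEval T.1 P = p} =>
    patternFormula P.vars T.1.1

variable {V : Type*} (G : SimpleGraph V) (a : ι → V)

theorem realize_distFormula (w : ι × ι × ℕ) :
    @Formula.Realize _ _ (distGraphStructure G) _ (distFormula w) a ↔
      G.edist (a w.1) (a w.2.1) = w.2.2 := by
  let _ := distGraphStructure G
  exact Formula.realize_rel₂

theorem realize_patternFormula {s T : Finset (ι × ι × ℕ)} (hT : T ⊆ s) :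
    @Formula.Realize _ _ (distGraphStructure G) _ (patternFormula s T) a ↔ G.pattern a s = T := by
  let _ := distGraphStructure G
  rw [SimpleGraph.pattern_eq_iff hT, patternFormula, Formula.Realize, BoundedFormula.realize_iInf,
    Subtype.forall]
  refine forall₂_congr fun w _ => ?_
  by_cases hw : w ∈ T
  · simpa [hw, Formula.Realize] using realize_distFormula G a w
  · simpa [hw, Formula.Realize] using (realize_distFormula G a w).not

theorem realize_valueFormula (P : DistPoly ι) (p : MvPolynomial (Fin 2) ℤ) :
    @Formula.Realize _ _ (distGraphStructure G) _ (valueFormula P p) a ↔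
      patternEval (G.pattern a P.vars) P = p := by
  let _ := distGraphStructure G
  rw [valueFormula, Formula.Realize, BoundedFormula.realize_iSup]
  constructor
  · rintro ⟨⟨⟨T, hT⟩, hp⟩, h⟩
    rwa [(realize_patternFormula G a (Finset.mem_powerset.1 hT)).1 h]
  · intro h
    have hsub := G.pattern_subset a P.vars
    exact ⟨⟨⟨_, Finset.mem_powerset.2 hsub⟩, h⟩, (realize_patternFormula G a hsub).2 rfl⟩

end ValueFormula

/-! ### Satisfiability, germs and the main theorem. -/

namespace GraphModel

/-- Whether a formula is satisfiable is the same for all regular graphs of sufficiently large degree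
and girth. -/
theorem eventually_exists_realize_or_not {ι : Type} [Finite ι]
    (ψ : distGraphLanguage.Formula ι) :
    (∀ᶠ M : GraphModel.{v} in goodFilter, ∃ a : ι → M.V, ψ.Realize a) ∨
      ∀ᶠ M : GraphModel.{v} in goodFilter, ¬∃ a : ι → M.V, ψ.Realize a := by
  let σ : distGraphLanguage.Formula Empty :=
    FirstOrder.Language.Formula.iExs ι (ψ.relabel (Sum.inr : ι → Empty ⊕ ι))
  have hσ : ∀ (M : GraphModel.{v}) (b : Empty ⊕ Fin 0 → M.V),
      FirstOrder.Language.BoundedFormula.Realize σ (b ∘ Sum.inl) (b ∘ Sum.inr) ↔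
        ∃ a : ι → M.V, ψ.Realize a := by
    intro M b
    rw [Subsingleton.elim (b ∘ Sum.inr) default, ← FirstOrder.Language.Formula.Realize,
      FirstOrder.Language.Formula.realize_iExs]
    simp [FirstOrder.Language.Formula.realize_relabel, Function.comp_def]
  obtain ⟨P, hP⟩ := tame_truthValue_realize.{v} σ
  -- A sentence has no variables to compare, so its truth value is one polynomial in the sizes, zero
  -- or eventually nonzero.
  have hP' : ∀ᶠ M : GraphModel.{v} in goodFilter,
      truthValue (∃ a : ι → M.V, ψ.Realize a) = M.sizeEval (patternEval ∅ P) := by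
    filter_upwards [hP] with M hM
    have := hM isEmptyElim
    rwa [hσ, distEval_eq_sizeEval, Finset.eq_empty_of_isEmpty (M.graph.pattern _ _)] at this
  by_cases h0 : patternEval ∅ P = 0
  · right
    filter_upwards [hP'] with M hM
    rw [h0, map_zero] at hM
    exact fun h => truthValue_ne_zero.2 h hM
  · left
    filter_upwards [hP', eventually_sizeEval_ne_zero h0] with M hM h
    exact truthValue_ne_zero.1 (hM ▸ h)

theorem aeval_germ_eq {I : Type*} {l : Filter I} (M : I → GraphModel.{v})
    (p : MvPolynomial (Fin 2) ℤ) :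
    MvPolynomial.aeval ![((fun i => (Fintype.card (M i).V : ℝ) : I → ℝ) : Germ l ℝ),
        ((fun i => ((M i).degree : ℝ) : I → ℝ) : Germ l ℝ)] p =
      ((fun i => ((M i).sizeEval p : ℝ) : I → ℝ) : Germ l ℝ) := by
  induction p using MvPolynomial.induction_on with
  | C c => simp [sizeEval]
  | add p q hp hq => rw [map_add, hp, hq, ← Germ.coe_add]; simp [Pi.add_def]
  | mul_X p j hp =>
    rw [map_mul, hp, MvPolynomial.aeval_X]
    simp only [map_mul, Int.cast_mul]
    fin_cases j <;> simp [sizeEval] <;> rfl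

end GraphModel

theorem mainTheorem7 (m : ℕ) (φ : distGraphLanguage.Formula (Unit ⊕ Fin m)) :
    ∃ (k : ℕ) (p : Fin k → MvPolynomial (Fin 2) ℤ) (ψ : Fin k → distGraphLanguage.Formula (Fin m)),
      ∀ (V : ℕ → Type*) [∀ n, Finite (V n)] (H : ∀ n, SimpleGraph (V n))
        [∀ n, (H n).LocallyFinite] (d : ℕ → ℕ) (u : Ultrafilter ℕ),
        (∀ n, (H n).IsRegularOfDegree (d n)) →
        Tendsto d atTop atTop →
        Tendsto (fun n => (H n).egirth) atTop (𝓝 ⊤) →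
        Infinite ((u : Filter ℕ).Product V) →
        letI : distGraphLanguage.Structure ((u : Filter ℕ).Product V) :=
          distGraphStructure (ultraproductGraph H u)
        let α : Germ (u : Filter ℕ) ℝ := ((fun n => (Nat.card (V n) : ℝ) : ℕ → ℝ) : Germ _ ℝ)
        let β : Germ (u : Filter ℕ) ℝ := ((fun n => (d n : ℝ) : ℕ → ℝ) : Germ _ ℝ)
        ((∀ i, ∃ a : Fin m → (u : Filter ℕ).Product V, (ψ i).Realize a) ∧
          (∀ a : Fin m → (u : Filter ℕ).Product V, ∃! i, (ψ i).Realize a)) ∧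
        ∀ (i : Fin k) (a : Fin m → (u : Filter ℕ).Product V),
          (ψ i).Realize a ↔
            HasNonstandardCard u {x | φ.Realize (Sum.elim (fun _ => x) a)}
              (MvPolynomial.aeval ![α, β] (p i)) := by
  classical
  obtain ⟨P, hP⟩ := GraphModel.tame_ncard_realize φ
  -- Only values attained in all sufficiently good graphs are kept. This makes the classes non-empty
  -- and the list independent of the sequence of graphs.
  let vals : Finset (MvPolynomial (Fin 2) ℤ) := (P.vars.powerset.image (patternEval · P)).filter
    fun p => ∀ᶠ M in GraphModel.goodFilter, ∃ a : Fin m → M.V, (valueFormula P p).Realize a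
  let e : Fin vals.card ≃ vals := vals.equivFin.symm
  refine ⟨vals.card, fun i => (e i).1, fun i => valueFormula P (e i).1, ?_⟩
  intro V _ H _ d u hreg hd hg hinf
  have hne : ∀ n, Nonempty (V n) := nonempty_of_infinite_product u
  have hu : (u : Filter ℕ) ≤ atTop := Nat.cofinite_eq_atTop ▸ le_cofinite_of_infinite_product (V := V) u
  have := fun n => Fintype.ofFinite (V n)
  let M : ℕ → GraphModel := fun n => ⟨V n, H n, d n⟩
  have hM : Tendsto M u GraphModel.goodFilter := by
    refine GraphModel.tendsto_goodFilter hne (fun n x => ?_) (hd.mono_left hu) (hg.mono_left hu)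
    refine Eq.trans ?_ (hreg n x)
    rw [← SimpleGraph.card_neighborFinset_eq_degree]
    congr 1
    ext y
    exact GraphModel.mem_nbrs.trans (SimpleGraph.mem_neighborFinset _ _ _).symm
  have hrep : ∀ a : Fin m → (u : Filter ℕ).Product V,
      ∃ x : Fin m → ∀ n, V n, (fun j => (x j : (u : Filter ℕ).Product V)) = a := fun a =>
    ⟨fun j => (a j).out, funext fun j => Quotient.out_eq _⟩
  intro α β
  let _ : distGraphLanguage.Structure ((u : Filter ℕ).Product V) :=
    distGraphStructure (ultraproductGraph H u)
  let _ : ∀ n, distGraphLanguage.Structure (V n) := fun n => distGraphStructure (H n)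
  beta_reduce
  have hvalue := realize_valueFormula (ultraproductGraph H u) (ι := Fin m)
  have hgerm : ∀ p, MvPolynomial.aeval ![α, β] p =
      ((fun n => ((M n).sizeEval p : ℝ) : ℕ → ℝ) : Germ (u : Filter ℕ) ℝ) := by
    intro p
    rw [← GraphModel.aeval_germ_eq]
    simp only [α, β, Nat.card_eq_fintype_card, M]
  refine ⟨⟨fun i => ?_, fun a => ?_⟩, fun i a => ?_⟩
  · have hex : ∀ n, ∃ a : Fin m → V n, (∃ a : Fin m → V n,
        (valueFormula P (e i).1).Realize a) → (valueFormula P (e i).1).Realize a := by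
      intro n
      by_cases h : ∃ a : Fin m → V n, (valueFormula P (e i).1).Realize a
      · exact h.imp fun a ha _ => ha
      · exact ⟨fun _ => Classical.arbitrary _, fun h' => absurd h' h⟩
    choose a ha using hex
    refine ⟨fun j => ((fun n => a n j : ∀ n, V n) : (u : Filter ℕ).Product V), ?_⟩
    refine (ultraproductGraph_realize_coe H u _ fun j n => a n j).2 ?_
    exact (hM.eventually (Finset.mem_filter.1 (e i).2).2).mono ha
  · have hmem : patternEval ((ultraproductGraph H u).pattern a P.vars) P ∈ vals := by
      refine Finset.mem_filter.2 ⟨Finset.mem_image_of_mem _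
        (Finset.mem_powerset.2 (SimpleGraph.pattern_subset _ _ _)), ?_⟩
      -- A discarded value is eventually attained nowhere, but by Łoś's theorem this one is attained
      -- at representatives of `a`.
      refine (GraphModel.eventually_exists_realize_or_not _).resolve_right fun hnot => ?_
      obtain ⟨x, rfl⟩ := hrep a
      have h1 := (ultraproductGraph_realize_coe H u _ x).1 ((hvalue _ P _).2 rfl)
      obtain ⟨n, hn1, hn2⟩ := (h1.and (hM.eventually hnot)).exists
      exact hn2 ⟨_, hn1⟩
    refine ⟨e.symm ⟨_, hmem⟩, (hvalue a P _).2 (by rw [Equiv.apply_symm_apply]), fun i hi => ?_⟩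
    rw [Equiv.eq_symm_apply]
    exact Subtype.ext ((hvalue a P _).1 hi).symm
  · obtain ⟨x, rfl⟩ := hrep a
    set a : Fin m → (u : Filter ℕ).Product V := fun j => (x j : (u : Filter ℕ).Product V)
    set p := patternEval ((ultraproductGraph H u).pattern a P.vars) P with hp
    have hcard : HasNonstandardCard u {y | φ.Realize (Sum.elim (fun _ => y) a)}
        (MvPolynomial.aeval ![α, β] p) := by
      refine ⟨fun n => {y | @FirstOrder.Language.Formula.Realize _ _ (distGraphStructure (H n)) _ φ
        (Sum.elim (fun _ => y) fun j => x j n)}, ?_, ?_⟩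
      · ext y
        obtain ⟨y, rfl⟩ := Quotient.exists_rep y
        refine Iff.trans ?_ (coe_mem_internalSet u _ y).symm
        have h := ultraproductGraph_realize_coe H u φ (Sum.elim (fun _ => y) x)
        have h1 : (fun j => ((Sum.elim (fun _ => y) x j : ∀ n, V n) : (u : Filter ℕ).Product V)) =
            Sum.elim (fun _ : Unit => (y : (u : Filter ℕ).Product V)) a := by
          funext j
          rcases j with j | j <;> rfl
        have h2 : ∀ n, (fun j => Sum.elim (fun _ : Unit => y) x j n) =
            Sum.elim (fun _ => y n) fun j => x j n := by
          intro n
          funext j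
          rcases j with j | j <;> rfl
        rw [h1] at h
        simp only [h2] at h
        exact h
      · rw [hgerm]
        refine Germ.coe_eq.2 ?_
        have h1 := (ultraproductGraph_realize_coe H u _ x).1 ((hvalue a P p).2 rfl)
        filter_upwards [h1, hM.eventually hP] with n h1 h2
        have h3 := h2 fun j => x j n
        rw [GraphModel.distEval_eq_sizeEval, (realize_valueFormula (H n) _ P p).1 h1] at h3
        exact_mod_cast h3.symm
    constructor
    · intro h
      rwa [← (hvalue a P _).1 h]
    · intro h
      refine (hvalue a P _).2 ?_
      by_contra hne'
      have heq := h.unique hcard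
      rw [hgerm, hgerm] at heq
      -- Distinct polynomials eventually take distinct values, so equal non-standard cardinalities
      -- force equal polynomials.
      have h1 := hM.eventually (GraphModel.eventually_sizeEval_ne_zero (sub_ne_zero.2 hne'))
      obtain ⟨n, hn1, hn2⟩ := (h1.and (Germ.coe_eq.1 heq)).exists
      refine hn1 ?_
      rw [map_sub, sub_eq_zero]
      exact_mod_cast hn2.symm
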